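/- Let $M$ be a connected smooth manifold of dimension $n\ge 2$ with a Finsler structure $F:TM\to[0,\infty)$: $F$ is $C^\infty$ on the slit tangent bundle $TM_0=\{(x,y)\in TM:y\ne0\}$, $F(x,\lambda y)=\lambda F(x,y)$ for $\lambda>0$, and $g_{ij}(x,y)=[\tfrac12F^2]_{y^iy^j}$ is positive definite at every point of $TM_0$. Let $G^i=\tfrac12 g^{il}\{[F^2]_{x^ky^l}y^k-[F^2]_{x^l}\}$ be the spray coefficients, let $R^i{}_k$ be given by $$2F^2R^i{}_k=2(G^i)_{x^k}-\tfrac12(G^i)_{y^j}(G^j)_{y^k}-y^j(G^i)_{y^kx^j}+G^j(G^i)_{y^ky^j},$$ and let $Ric=R^i{}_i$ and $Ric_{ik}=\tfrac12(F^2Ric)_{y^iy^k}$ (the Ricci tensor of Akbar-Zadeh). A geodesic with arc-length parameter $s$ is a smooth curve with $\frac{d^2x^i}{ds^2}+G^i(x,\frac{dx}{ds})=0$ and $F(x,\frac{dx}{ds})=1$. A map $f:I=(-1,1)\to M$ is called projective if it is a positively oriented reparametrization of such a geodesic, $f(u)=x(s(u))$ with $ds/du>0$, whose parameter $u$, as a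 smooth function of the arc length $s$ with $du/ds>0$, satisfies $$\{u,s\}:=\frac{u'''}{u'}-\frac32\Big(\frac{u''}{u'}\Big)^2=\frac{2}{n-1}\,Ric_{jk}\Big(x,\frac{dx}{ds}\Big)\frac{dx^j}{ds}\frac{dx^k}{ds}.$$ Suppose that for some constant $c>0$ the inequality $Ric_{ij}\le -c^2g_{ij}$ holds, in the sense of symmetric matrices, at every point of $TM_0$. Then every projective map $f:I\to M$ satisfies $$\tilde f^*(ds_M^2)\le\frac{n-1}{4c^2}\,ds_I^2\quad\text{on } I,$$ where $ds_I^2=\frac{4\,du^2}{(1-u^2)^2}$ is the Poincaré metric of $I$, $\tilde f(u)=(f(u),f'(u))$ is the natural lift of $f$ to $TM$, and $\tilde f^*(ds_M^2)=g_{ij}(f(u),f'(u))\,\frac{df^i}{du}\frac{df^j}{du}\,du^2$ is the pullback of the Finsler line element. -/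

import Mathlib

open Set
open scoped Manifold ContDiff

noncomputable section

namespace FinslerSpace

/-! ### Calculus in local coordinates `(x, y)` on the tangent bundle -/

section Coordinates

variable {n : ℕ}

/-- Partial derivative `∂H/∂xᵏ` of a function of the coordinates `(x, y)`. -/
def dx (k : Fin n) (H : EuclideanSpace ℝ (Fin n) × EuclideanSpace ℝ (Fin n) → ℝ) :
    EuclideanSpace ℝ (Fin n) × EuclideanSpace ℝ (Fin n) → ℝ :=
  fun z => fderiv ℝ H z (EuclideanSpace.single k 1, 0)

/-- Partial derivative `∂H/∂yᵏ` of a function of the coordinates `(x, y)`. -/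
def dy (k : Fin n) (H : EuclideanSpace ℝ (Fin n) × EuclideanSpace ℝ (Fin n) → ℝ) :
    EuclideanSpace ℝ (Fin n) × EuclideanSpace ℝ (Fin n) → ℝ :=
  fun z => fderiv ℝ H z (0, EuclideanSpace.single k 1)

variable (L : EuclideanSpace ℝ (Fin n) × EuclideanSpace ℝ (Fin n) → ℝ)

/-- The fundamental tensor `g_ij = (½ L²)_{yⁱ yʲ}` of a Finsler function `L(x, y)`. -/
def gCoord (z : EuclideanSpace ℝ (Fin n) × EuclideanSpace ℝ (Fin n)) :
    Matrix (Fin n) (Fin n) ℝ :=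
  Matrix.of fun i j => dy j (dy i (fun w => (1 / 2) * L w ^ 2)) z

/-- The spray coefficients `Gⁱ = ½ gⁱˡ ([L²]_{xᵏ yˡ} yᵏ - [L²]_{xˡ})`. -/
def sprayCoord (i : Fin n) (z : EuclideanSpace ℝ (Fin n) × EuclideanSpace ℝ (Fin n)) : ℝ :=
  (1 / 2) * ∑ l, (gCoord L z)⁻¹ i l *
    ((∑ k, dx k (dy l (fun w => L w ^ 2)) z * z.2 k) - dx l (fun w => L w ^ 2) z)

/-- The Riemann curvature `Rⁱ_k`, homogeneous of degree zero in `y`, given by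
`2 L² Rⁱ_k = 2 (Gⁱ)_{xᵏ} - ½ (Gⁱ)_{yʲ} (Gʲ)_{yᵏ} - yʲ (Gⁱ)_{yᵏ xʲ} + Gʲ (Gⁱ)_{yᵏ yʲ}`. -/
def riemannCoord (i k : Fin n)
    (z : EuclideanSpace ℝ (Fin n) × EuclideanSpace ℝ (Fin n)) : ℝ :=
  (1 / (2 * L z ^ 2)) *
    (2 * dx k (sprayCoord L i) z
      - (1 / 2) * ∑ j, dy j (sprayCoord L i) z * dy k (sprayCoord L j) z
      - ∑ j, z.2 j * dx j (dy k (sprayCoord L i)) z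
      + ∑ j, sprayCoord L j z * dy j (dy k (sprayCoord L i)) z)

/-- The Ricci scalar `Ric = Rⁱ_i`. -/
def ricciScalarCoord (z : EuclideanSpace ℝ (Fin n) × EuclideanSpace ℝ (Fin n)) : ℝ :=
  ∑ i, riemannCoord L i i z

/-- The Ricci tensor of Akbar-Zadeh, `Ric_ik = ½ (L² Ric)_{yⁱ yᵏ}`. -/
def ricciCoord (z : EuclideanSpace ℝ (Fin n) × EuclideanSpace ℝ (Fin n)) :
    Matrix (Fin n) (Fin n) ℝ :=
  Matrix.of fun i k =>
    (1 / 2) * dy k (dy i (fun w => L w ^ 2 * ricciScalarCoord L w)) z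

end Coordinates

/-! ### Finsler structures on a manifold -/

section Manifold

variable {n : ℕ} {M : Type*} [TopologicalSpace M] [ChartedSpace (EuclideanSpace ℝ (Fin n)) M]

/-- The expression of `F : TM → ℝ` in the preferred chart `φ` at `p`, namely
`(x, y) ↦ F (φ⁻¹ x, d(φ⁻¹)_x y)`. -/
def inChart (F : TangentBundle (𝓡 n) M → ℝ) (p : M)
    (z : EuclideanSpace ℝ (Fin n) × EuclideanSpace ℝ (Fin n)) : ℝ :=
  F ⟨(chartAt (EuclideanSpace ℝ (Fin n)) p).symm z.1,
    mfderiv (𝓡 n) (𝓡 n) (chartAt (EuclideanSpace ℝ (Fin n)) p).symm z.1 z.2⟩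

/-- The components of a tangent vector in the preferred chart at its base point
(an element of `TangentSpace (𝓡 n) x` is by definition given by these components). -/
def comp (v : TangentBundle (𝓡 n) M) : EuclideanSpace ℝ (Fin n) := v.2

/-- The coordinates `(x, y)` of a tangent vector in the preferred chart at its base point. -/
def coords (v : TangentBundle (𝓡 n) M) :
    EuclideanSpace ℝ (Fin n) × EuclideanSpace ℝ (Fin n) :=
  (chartAt (EuclideanSpace ℝ (Fin n)) v.proj v.proj, comp v)

/-- The fundamental tensor `g_ij(x, y)` at `v = (x, y)`, in the preferred chart at `x`. -/
def g (F : TangentBundle (𝓡 n) M → ℝ) (v : TangentBundle (𝓡 n) M) :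
    Matrix (Fin n) (Fin n) ℝ :=
  gCoord (inChart F v.proj) (coords v)

/-- The Ricci tensor `Ric_ij(x, y)` at `v = (x, y)`, in the preferred chart at `x`. -/
def ricci (F : TangentBundle (𝓡 n) M → ℝ) (v : TangentBundle (𝓡 n) M) :
    Matrix (Fin n) (Fin n) ℝ :=
  ricciCoord (inChart F v.proj) (coords v)

/-- The spray coefficient `Gⁱ(x, y)` at `v = (x, y)`, in the preferred chart at `x`. -/
def spray (F : TangentBundle (𝓡 n) M → ℝ) (i : Fin n) (v : TangentBundle (𝓡 n) M) : ℝ :=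
  sprayCoord (inChart F v.proj) i (coords v)

/-- `F : TM → [0, ∞)` is a Finsler structure: smooth on the slit tangent bundle, positively
homogeneous, and strongly convex. -/
structure IsFinsler [IsManifold (𝓡 n) ∞ M] (F : TangentBundle (𝓡 n) M → ℝ) : Prop where
  nonneg : ∀ v, 0 ≤ F v
  smooth : ContMDiffOn (𝓡 n).tangent 𝓘(ℝ, ℝ) ∞ F {v : TangentBundle (𝓡 n) M | v.2 ≠ 0}
  homogeneous : ∀ (x : M) (y : TangentSpace (𝓡 n) x) (t : ℝ), 0 < t →
    F ⟨x, t • y⟩ = t * F ⟨x, y⟩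
  convex : ∀ v : TangentBundle (𝓡 n) M, v.2 ≠ 0 → (g F v).PosDef

/-! ### Geodesics and projective maps -/

/-- The natural lift `u ↦ (f u, f' u)` of a curve to the tangent bundle. -/
def lift (f : ℝ → M) (u : ℝ) : TangentBundle (𝓡 n) M :=
  ⟨f u, mfderiv 𝓘(ℝ, ℝ) (𝓡 n) f u (1 : ℝ)⟩

/-- `γ` is, on the open set `J`, a geodesic parametrized by arc length: in coordinates
`d²xⁱ/ds² + Gⁱ(x, dx/ds) = 0` and `F(x, dx/ds) = 1`. -/
structure IsArcLengthGeodesicOn (F : TangentBundle (𝓡 n) M → ℝ) (γ : ℝ → M) (J : Set ℝ) :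
    Prop where
  smooth : ContMDiffOn 𝓘(ℝ, ℝ) (𝓡 n) ∞ γ J
  unit_speed : ∀ s ∈ J, F (lift (n := n) γ s) = 1
  geodesic_eq : ∀ s ∈ J, ∀ i : Fin n,
    (deriv (deriv fun t => chartAt (EuclideanSpace ℝ (Fin n)) (γ s) (γ t)) s) i
      + spray F i (lift γ s) = 0

/-- The Schwarzian derivative `{p, s} = p'''/p' - (3/2) (p''/p')²`. -/
def schwarzian (p : ℝ → ℝ) (s : ℝ) : ℝ :=
  iteratedDeriv 3 p s / deriv p s - 3 / 2 * (iteratedDeriv 2 p s / deriv p s) ^ 2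

/-- The smooth function `p`, with `p' > 0`, of the arc length `s ∈ J` is a projective parameter
of the arc length geodesic `γ`: `{p, s} = 2 / (n - 1) Ric_jk (dxʲ/ds) (dxᵏ/ds)`. -/
structure IsProjectiveParameterOn (F : TangentBundle (𝓡 n) M → ℝ) (γ : ℝ → M) (p : ℝ → ℝ)
    (J : Set ℝ) : Prop where
  smooth : ContDiffOn ℝ ∞ p J
  deriv_pos : ∀ s ∈ J, 0 < deriv p s
  schwarzian_eq : ∀ s ∈ J, schwarzian p s = 2 / ((n : ℝ) - 1) *
    ∑ j, ∑ k, ricci F (lift γ s) j k * comp (lift (n := n) γ s) j * comp (lift (n := n) γ s) k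

/-- `f : (-1, 1) → M` is a projective map: a geodesic whose parameter `u ∈ (-1, 1)` is a
projective parameter, that is, `f (p s) = γ s` where `γ : J → M` is a geodesic parametrized by
arc length `s` and `u = p s` is a projective parameter of `γ` mapping the open interval `J`
onto `(-1, 1)`. The values of `f` outside `(-1, 1)` are irrelevant. -/
def IsProjectiveMap (F : TangentBundle (𝓡 n) M → ℝ) (f : ℝ → M) : Prop :=
  ∃ (J : Set ℝ) (γ : ℝ → M) (p : ℝ → ℝ),
    IsOpen J ∧ J.OrdConnected ∧ IsArcLengthGeodesicOn F γ J ∧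
    IsProjectiveParameterOn F γ p J ∧ BijOn p J (Ioo (-1) 1) ∧ ∀ s ∈ J, f (p s) = γ s

/-- The pullback by the natural lift of `f` of `ds_M² = g_ij dxⁱ dxʲ`, as a quadratic form on
the tangent line at `u`: `ξ ↦ g_ij(f u, f' u) (df ξ)ⁱ (df ξ)ʲ`. -/
def pullbackLineElementSq (F : TangentBundle (𝓡 n) M → ℝ) (f : ℝ → M) (u ξ : ℝ) : ℝ :=
  ∑ i, ∑ j, g F (lift f u) i j * comp ⟨f u, mfderiv 𝓘(ℝ, ℝ) (𝓡 n) f u ξ⟩ i *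
    comp ⟨f u, mfderiv 𝓘(ℝ, ℝ) (𝓡 n) f u ξ⟩ j

/-- The Poincaré metric `ds_I² = 4 du² / (1 - u²)²` of `(-1, 1)`, as a quadratic form on the
tangent line at `u`. -/
def poincareSq (u ξ : ℝ) : ℝ := 4 * ξ ^ 2 / (1 - u ^ 2) ^ 2

end Manifold

end FinslerSpace

end

/-! ### A Schwarz lemma on the interval -/

open scoped Topology

/-! The statement reduces to one variable. By Euler's relation for the 2-homogeneous function
`F²/2`, `g_ij yⁱ yʲ = F²`, so along a unit speed geodesic the Ricci bound makes the Schwarzian of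
the projective parameter `p` at most `-2k²` with `k² = c²/(n-1)`. Since `γ = f ∘ p` has unit speed,
`F(f, f') = 1/p'`, and the claim becomes `k (1 - p²) ≤ p'`, with equality for the model `p = tanh (k
s)`.

This inequality (`one_sub_sq_le_of_schwarzian_le`) comes from the maximum principle. For `φ = (r² -
p²)/p'`, at a critical point `φ φ'' = -2r² - φ² {p, s}`; at a positive maximum the left side is
nonpositive, so `k φ ≤ r`. -/

/-- The second derivative is nonpositive at a local maximum. -/
theorem IsLocalMax.second_deriv_nonpos {φ φ₁ : ℝ → ℝ} {m d : ℝ} (hmax : IsLocalMax φ m)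
    (h₁ : ∀ᶠ s in nhds m, HasDerivAt φ (φ₁ s) s) (h₂ : HasDerivAt φ₁ d m) : d ≤ 0 := by
  by_contra! hd
  have e : deriv φ =ᶠ[nhds m] φ₁ := h₁.mono fun s hs => hs.deriv
  have hmin : IsLocalMin φ m := by
    apply isLocalMin_of_deriv_deriv_pos
    · rw [e.deriv_eq, h₂.deriv]; exact hd
    · exact hmax.deriv_eq_zero
    · exact h₁.self_of_nhds.continuousAt
  -- A point that is both a local maximum and a local minimum has `φ` constant around it, so `d =
  -- 0`.
  have hc : φ =ᶠ[nhds m] fun _ => φ m := by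
    filter_upwards [hmax, hmin] with s h h' using le_antisymm h h'
  have h0 : deriv φ =ᶠ[nhds m] fun _ => 0 := by
    refine hc.eventuallyEq_nhds.mono fun s hs => ?_
    rw [hs.deriv_eq, deriv_const]
  have := (e.symm.trans h0).deriv_eq
  rw [h₂.deriv, deriv_const] at this
  exact hd.ne' this

/-- A one-dimensional Schwarz lemma: a diffeomorphism `p` of an open interval onto `(-1, 1)` whose
Schwarzian derivative is at most `-2 k²` satisfies `k (1 - p²) ≤ p'`. The proof maximizes
`(r² - p²) / p'` for `r < 1` and lets `r` tend to `1`. -/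
theorem FinslerSpace.one_sub_sq_le_of_schwarzian_le {p : ℝ → ℝ} {J : Set ℝ} (hJ : IsOpen J)
    (hJc : J.OrdConnected) (hp : ContDiffOn ℝ ∞ p J) (hpos : ∀ s ∈ J, 0 < deriv p s)
    (hbij : BijOn p J (Ioo (-1) 1)) {k : ℝ} (hk : 0 < k)
    (hS : ∀ s ∈ J, schwarzian p s ≤ -2 * k ^ 2) {s₀ : ℝ} (hs₀ : s₀ ∈ J) :
    k * (1 - p s₀ ^ 2) ≤ deriv p s₀ := by
  have hmono : StrictMonoOn p J :=
    strictMonoOn_of_deriv_pos hJc.convex hp.continuousOn fun s hs =>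
      hpos s (interior_subset hs)
  have c1 : ContDiffOn ℝ ∞ (deriv p) J := hp.deriv_of_isOpen hJ (by simp)
  have c2 : ContDiffOn ℝ ∞ (deriv (deriv p)) J := c1.deriv_of_isOpen hJ (by simp)
  have D : ∀ q : ℝ → ℝ, ContDiffOn ℝ ∞ q J → ∀ s ∈ J, HasDerivAt q (deriv q s) s :=
    fun q hq s hs => ((hq.contDiffAt (hJ.mem_nhds hs)).differentiableAt (by simp)).hasDerivAt
  have key : ∀ r : ℝ, |p s₀| < r → r < 1 → k * (r ^ 2 - p s₀ ^ 2) ≤ r * deriv p s₀ := by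
    intro r hr hr1
    have hr0 : 0 < r := (abs_nonneg _).trans_lt hr
    -- Since `r < 1`, the set `|p| ≤ r` is a compact interval `[a, b]` in `J`. There `φ` vanishes at
    -- the ends and is positive at `s₀`, so its maximum is interior.
    obtain ⟨a, haJ, ha⟩ := hbij.surjOn (show -r ∈ Ioo (-1 : ℝ) 1 from ⟨by linarith, by linarith⟩)
    obtain ⟨b, hbJ, hb⟩ := hbij.surjOn (show r ∈ Ioo (-1 : ℝ) 1 from ⟨by linarith, by linarith⟩)
    have has : a < s₀ := (hmono.lt_iff_lt haJ hs₀).1 (by rw [ha]; exact (abs_lt.1 hr).1)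
    have hsb : s₀ < b := (hmono.lt_iff_lt hs₀ hbJ).1 (by rw [hb]; exact (abs_lt.1 hr).2)
    have hsub : Icc a b ⊆ J := hJc.out haJ hbJ
    set φ : ℝ → ℝ := fun s => (r ^ 2 - p s ^ 2) / deriv p s with hφ
    have dφ : ∀ s ∈ J, HasDerivAt φ
        (-2 * p s - (r ^ 2 - p s ^ 2) * deriv (deriv p) s / deriv p s ^ 2) s := by
      intro s hs
      have hne := (hpos s hs).ne'
      refine ((((D p hp s hs).pow 2).const_sub (r ^ 2)).div (D _ c1 s hs) hne).congr_deriv ?_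
      norm_num
      field_simp
    obtain ⟨m, hm, hmax⟩ := isCompact_Icc.exists_isMaxOn (nonempty_Icc.2 (has.trans hsb).le)
      (fun s hs => (dφ s (hsub hs)).continuousAt.continuousWithinAt)
    have hle : φ s₀ ≤ φ m := hmax ⟨has.le, hsb.le⟩
    have hP0 := hpos s₀ hs₀
    have hφ0 : 0 < φ s₀ := div_pos (by nlinarith [abs_lt.1 hr]) hP0
    have hφm : 0 < φ m := hφ0.trans_le hle
    have hma : m ≠ a := by rintro rfl; simp [hφ, ha] at hφm
    have hmb : m ≠ b := by rintro rfl; simp [hφ, hb] at hφm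
    have hmI : Icc a b ∈ nhds m :=
      Icc_mem_nhds (lt_of_le_of_ne hm.1 hma.symm) (lt_of_le_of_ne hm.2 hmb)
    have hlm : IsLocalMax φ m := hmax.isLocalMax hmI
    have hmJ := hsub hm
    have hP := hpos m hmJ
    have hcrit := hlm.hasDerivAt_eq_zero (dφ m hmJ)
    have dd := (((D p hp m hmJ).const_mul (-2)).sub
      (((((D p hp m hmJ).pow 2).const_sub (r ^ 2)).mul (D _ c2 m hmJ)).div
        ((D _ c1 m hmJ).pow 2) (pow_pos hP 2).ne'))
    have h2 := IsLocalMax.second_deriv_nonpos hlm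
      (by filter_upwards [hJ.mem_nhds hmJ] with s hs using dφ s hs) dd
    have hSm := hS m hmJ
    have hs : schwarzian p m = deriv (deriv (deriv p)) m / deriv p m
        - 3 / 2 * (deriv (deriv p) m / deriv p m) ^ 2 := by
      simp [schwarzian, iteratedDeriv_succ]
    rw [hs] at hSm
    have hA : r ^ 2 - p m ^ 2 = φ m * deriv p m := by simp only [hφ]; field_simp
    simp only [Pi.pow_apply] at h2
    have hr2 : r ^ 2 = p m ^ 2 + φ m * deriv p m := by linarith
    rw [hA] at hcrit
    simp only [Pi.mul_apply, hA] at h2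
    generalize deriv (deriv (deriv p)) m = T at *
    generalize deriv (deriv p) m = Q at *
    generalize deriv p m = P at *
    generalize p m = x at *
    generalize φ m = y at *
    -- The critical equation `φ' = -2p - φ p''/p' = 0`, solved for `p`.
    have hx : x = - y * Q / (2 * P) := by field_simp at hcrit ⊢; linarith
    have h3 : 2 * k ^ 2 * y ^ 2 ≤ 2 * r ^ 2 := by
      have h4 : 2 * k ^ 2 * y ^ 2 ≤ - (T / P - 3 / 2 * (Q / P) ^ 2) * y ^ 2 :=
        mul_le_mul_of_nonneg_right (by linarith) (by positivity)
      refine h4.trans ?_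
      -- Multiplied by `-φ`, the inequality `φ'' ≤ 0` becomes `0 ≤ 2r² + φ² {p, s}`, because `φ²
      -- (p''/p')² = 4p²` and `p² + φ p' = r²`.
      have h5 := mul_nonneg_of_nonpos_of_nonpos h2 (show -y ≤ 0 by linarith)
      rw [hr2, hx]
      rw [hx] at h5
      rw [← sub_nonneg]
      refine h5.trans_eq ?_
      simp
      field_simp
      ring
    have hky : k * y ≤ r := by
      apply le_of_sq_le_sq _ hr0.le
      nlinarith
    have h6 : k * φ s₀ ≤ r := (mul_le_mul_of_nonneg_left hle hk.le).trans hky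
    have h7 : r ^ 2 - p s₀ ^ 2 = φ s₀ * deriv p s₀ := by simp only [hφ]; field_simp
    rw [h7, ← mul_assoc]
    exact mul_le_mul_of_nonneg_right h6 hP0.le
  have h1 : |p s₀| < 1 := abs_lt.2 (hbij.mapsTo hs₀)
  have lim : ∀ᶠ r in nhdsWithin (1 : ℝ) (Iio 1),
      k * (r ^ 2 - p s₀ ^ 2) ≤ r * deriv p s₀ := by
    filter_upwards [Ioo_mem_nhdsLT h1] with r hr using key r hr.1 hr.2
  have t1 : Filter.Tendsto (fun r : ℝ => k * (r ^ 2 - p s₀ ^ 2)) (nhdsWithin 1 (Iio 1))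
      (nhds (k * (1 ^ 2 - p s₀ ^ 2))) :=
    (Continuous.tendsto (by fun_prop) 1).mono_left nhdsWithin_le_nhds
  have t2 : Filter.Tendsto (fun r : ℝ => r * deriv p s₀) (nhdsWithin 1 (Iio 1))
      (nhds (1 * deriv p s₀)) :=
    (Continuous.tendsto (by fun_prop) 1).mono_left nhdsWithin_le_nhds
  simpa using le_of_tendsto_of_tendsto t1 t2 lim

/-! ### Second derivatives of homogeneous functions -/

namespace FinslerSpace

/-- Bilinearity of the second derivative turns the coordinate sum into a derivative along the
vertical direction `y`, where Euler's relation applies. -/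
theorem sum_dy_dy_mul_mul {n : ℕ} {H : EuclideanSpace ℝ (Fin n) × EuclideanSpace ℝ (Fin n) → ℝ}
    {z : EuclideanSpace ℝ (Fin n) × EuclideanSpace ℝ (Fin n)} (hH : ContDiffAt ℝ 2 H z)
    (y : EuclideanSpace ℝ (Fin n)) :
    ∑ i, ∑ j, dy j (dy i H) z * y i * y j = fderiv ℝ (fderiv ℝ H) z (0, y) (0, y) := by
  have hd : DifferentiableAt ℝ (fderiv ℝ H) z :=
    (hH.fderiv_right (m := 1) (by norm_num)).differentiableAt (by norm_num)
  have e : ∀ i j, dy j (dy i H) z = fderiv ℝ (fderiv ℝ H) z (0, EuclideanSpace.single j 1)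
      (0, EuclideanSpace.single i 1) := by
    intro i j
    have := hd.hasFDerivAt.clm_apply (hasFDerivAt_const
      ((0, EuclideanSpace.single i 1) : EuclideanSpace ℝ (Fin n) × EuclideanSpace ℝ (Fin n)) z)
    change fderiv ℝ (fun w => fderiv ℝ H w (0, EuclideanSpace.single i 1)) z _ = _
    rw [this.fderiv]
    simp
  have hy : ((0, y) : EuclideanSpace ℝ (Fin n) × EuclideanSpace ℝ (Fin n)) =
      ∑ i, y i • ((0, EuclideanSpace.single i 1) :
        EuclideanSpace ℝ (Fin n) × EuclideanSpace ℝ (Fin n)) := by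
    ext i
    · simp [Prod.fst_sum]
    · simp [Prod.snd_sum, Finset.sum_apply, Pi.single_apply]
  rw [hy]
  simp only [map_sum, map_smul, sum_apply, smul_apply,
    smul_eq_mul, e]
  refine Finset.sum_congr rfl fun i _ => ?_
  rw [Finset.mul_sum]
  refine Finset.sum_congr rfl fun j _ => ?_
  ring

/-- Euler's relation for the second derivative of a function that is homogeneous of degree two. -/
theorem fderiv_fderiv_of_homogeneous {E : Type*} [NormedAddCommGroup E] [NormedSpace ℝ E]
    {H : E × E → ℝ} {z : E × E} (hH : ContDiffAt ℝ 2 H z)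
    (hom : ∀ t : ℝ, 0 < t → H (z.1, t • z.2) = t ^ 2 * H z) :
    fderiv ℝ (fderiv ℝ H) z (0, z.2) (0, z.2) = 2 * H z := by
  have hd : DifferentiableAt ℝ (fderiv ℝ H) z :=
    (hH.fderiv_right (m := 1) (by norm_num)).differentiableAt (by norm_num)
  -- On this ray `H` equals `t² H z`; both sides are differentiated twice at `t = 1`.
  set ℓ : ℝ → E × E := fun t => (z.1, t • z.2) with hℓ
  have dℓ : ∀ t, HasDerivAt ℓ (0, z.2) t := fun t => by
    simpa using (hasDerivAt_const t z.1).prodMk ((hasDerivAt_id t).smul_const z.2)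
  have hℓ1 : ℓ 1 = z := by simp [hℓ]
  have ev : ∀ᶠ w in 𝓝 (ℓ 1), DifferentiableAt ℝ H w := by
    rw [hℓ1]
    exact (hH.eventually (by simp)).mono fun w hw => hw.differentiableAt (by norm_num)
  have ev1 : ∀ᶠ t in 𝓝 (1 : ℝ), fderiv ℝ H (ℓ t) (0, z.2) = 2 * t * H z := by
    filter_upwards [(dℓ 1).continuousAt.eventually ev, Ioi_mem_nhds one_pos] with t ht ht0
    have h1 : HasDerivAt (fun t => H (ℓ t)) (fderiv ℝ H (ℓ t) (0, z.2)) t :=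
      ht.hasFDerivAt.comp_hasDerivAt t (dℓ t)
    have h2 : HasDerivAt (fun t : ℝ => t ^ 2 * H z) (2 * t * H z) t := by
      simpa using ((hasDerivAt_id t).pow 2).mul_const (H z)
    refine h1.unique (h2.congr_of_eventuallyEq ?_)
    filter_upwards [Ioi_mem_nhds ht0] with r hr using hom r hr
  have h1 : HasDerivAt (fun t => fderiv ℝ H (ℓ t) (0, z.2))
      (fderiv ℝ (fderiv ℝ H) (ℓ 1) (0, z.2) (0, z.2)) 1 := by
    have := HasFDerivAt.comp_hasDerivAt (1 : ℝ) (by rw [hℓ1]; exact hd.hasFDerivAt) (dℓ 1)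
    simpa [hℓ1] using this.clm_apply (hasDerivAt_const 1 ((0, z.2) : E × E))
  have h2 : HasDerivAt (fun t : ℝ => 2 * t * H z) (2 * H z) 1 := by
    simpa using ((hasDerivAt_id (1 : ℝ)).const_mul 2).mul_const (H z)
  rw [hℓ1] at h1
  exact h1.unique (h2.congr_of_eventuallyEq ev1)

/-! ### Finsler structures in charts, and lifts of curves -/

section Manifold

variable {n : ℕ} {M : Type*} [TopologicalSpace M] [ChartedSpace (EuclideanSpace ℝ (Fin n)) M]

/-- Identifies the coordinate expression of `F` with the one in the atlas of `TM`, so that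
smoothness on the manifold gives smoothness in coordinates. -/
theorem inChart_eq_chartAt_symm [IsManifold (𝓡 n) ∞ M] (F : TangentBundle (𝓡 n) M → ℝ)
    (v : TangentBundle (𝓡 n) M) {z : EuclideanSpace ℝ (Fin n) × EuclideanSpace ℝ (Fin n)}
    (hz : z.1 ∈ (chartAt (EuclideanSpace ℝ (Fin n)) v.proj).target) :
    inChart F v.proj z =
      F ((chartAt (ModelProd (EuclideanSpace ℝ (Fin n)) (EuclideanSpace ℝ (Fin n))) v).symm z) := by
  have := tangentMap_chart_symm (I := 𝓡 n) (p := v) (q := ⟨z.1, z.2⟩) hz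
  exact congrArg F this

theorem chartAt_self_eq_coords [IsManifold (𝓡 n) ∞ M] (v : TangentBundle (𝓡 n) M) :
    chartAt (ModelProd (EuclideanSpace ℝ (Fin n)) (EuclideanSpace ℝ (Fin n))) v v = coords v := by
  refine Prod.ext rfl ?_
  simp only [coords, comp, TangentBundle.chartAt]
  exact tangentCoordChange_self (I := 𝓡 n) (mem_extChartAt_source v.proj)

theorem IsFinsler.contDiffAt_inChart [IsManifold (𝓡 n) ∞ M] {F : TangentBundle (𝓡 n) M → ℝ}
    (hF : IsFinsler F) {v : TangentBundle (𝓡 n) M} (hv : v.2 ≠ 0) :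
    ContDiffAt ℝ ∞ (inChart F v.proj) (coords v) := by
  set e := chartAt (ModelProd (EuclideanSpace ℝ (Fin n)) (EuclideanSpace ℝ (Fin n))) v with he
  set U : Set (ModelProd (EuclideanSpace ℝ (Fin n)) (EuclideanSpace ℝ (Fin n))) :=
    e.target ∩ {z | z.2 ≠ 0} with hU
  have hUo : IsOpen U := e.open_target.inter
    (isOpen_compl_singleton.preimage (continuous_snd (X := EuclideanSpace ℝ (Fin n))))
  have h0 : e v ∈ e.target := mem_chart_target _ v
  rw [he, chartAt_self_eq_coords, ← he] at h0
  have hvU : coords v ∈ U := ⟨h0, hv⟩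
  have hs : ContMDiffOn (𝓡 n).tangent (𝓡 n).tangent ∞ e.symm e.target := contMDiffOn_chart_symm
  -- Coordinate changes are linear on fibres, so a zero vector would have zero coordinates.
  have hm : MapsTo e.symm U {w : TangentBundle (𝓡 n) M | w.2 ≠ 0} := by
    intro z hz h
    apply hz.2
    rw [← e.right_inv hz.1]
    exact (congrArg (fun y : EuclideanSpace ℝ (Fin n) =>
      tangentCoordChange (𝓡 n) (e.symm z).proj v.proj (e.symm z).proj y) h).trans (map_zero _)
  have hc := hF.smooth.comp (hs.mono inter_subset_left) hm
  have hc' : ContDiffOn ℝ ∞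
      (fun z : EuclideanSpace ℝ (Fin n) × EuclideanSpace ℝ (Fin n) => F (e.symm z)) U := by
    rw [← contMDiffOn_iff_contDiffOn, modelWithCornersSelf_prod]
    exact hc
  refine (hc'.contDiffAt (hUo.mem_nhds hvU)).congr_of_eventuallyEq ?_
  filter_upwards [hUo.mem_nhds hvU] with z hz
  exact inChart_eq_chartAt_symm F v ((TangentBundle.mem_chart_target_iff z v).1 hz.1)

/-- Euler's relation for `H = F²/2`, whose second derivative along `y` is `2H`. -/
theorem IsFinsler.sum_g_mul_mul [IsManifold (𝓡 n) ∞ M] {F : TangentBundle (𝓡 n) M → ℝ}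
    (hF : IsFinsler F) {v : TangentBundle (𝓡 n) M} (hv : v.2 ≠ 0) :
    ∑ i, ∑ j, g F v i j * comp v i * comp v j = F v ^ 2 := by
  have hC : ContDiffAt ℝ 2 (fun w => (1 / 2) * inChart F v.proj w ^ 2) (coords v) :=
    contDiffAt_const.mul (((hF.contDiffAt_inChart hv).of_le (m := 2) (WithTop.coe_le_coe.2 (le_top : (2 : ℕ∞) ≤ ⊤))).pow 2)
  refine (sum_dy_dy_mul_mul hC (comp v)).trans ?_
  rw [show comp v = (coords v).2 from rfl, fderiv_fderiv_of_homogeneous hC]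
  · have : inChart F v.proj (coords v) = F v := by
      rw [inChart_eq_chartAt_symm, ← chartAt_self_eq_coords, OpenPartialHomeomorph.left_inv]
      · exact mem_chart_source _ v
      · exact mem_chart_target _ v.proj
    rw [this]
    ring
  · intro t ht
    have : inChart F v.proj ((coords v).1, t • (coords v).2) =
        t * inChart F v.proj (coords v) := by
      exact (congrArg (fun y => F ⟨_, y⟩) (map_smul (mfderiv (𝓡 n) (𝓡 n)
        (chartAt (EuclideanSpace ℝ (Fin n)) v.proj).symm (coords v).1) t (coords v).2)).trans
        (hF.homogeneous _ _ t ht)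
    rw [this]
    ring

theorem lift_congr {f f' : ℝ → M} {u : ℝ} (h : f =ᶠ[𝓝 u] f') :
    lift (n := n) f u = lift f' u := by
  -- All tangent spaces are definitionally the model space, which allows vectors at `a` and `b` to
  -- be compared.
  have aux : ∀ (a b : M) (x y : EuclideanSpace ℝ (Fin n)), a = b → x = y →
      (⟨a, x⟩ : TangentBundle (𝓡 n) M) = ⟨b, y⟩ := by rintro a _ x _ rfl rfl; rfl
  exact aux _ _ _ _ h.self_of_nhds
    (congrArg (fun A : ℝ →L[ℝ] EuclideanSpace ℝ (Fin n) => A 1) h.mfderiv_eq)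

theorem lift_comp {f : ℝ → M} {p : ℝ → ℝ} {s : ℝ} (hf : MDifferentiableAt 𝓘(ℝ, ℝ) (𝓡 n) f (p s))
    (hp : DifferentiableAt ℝ p s) :
    lift (n := n) (f ∘ p) s = ⟨f (p s), deriv p s • (lift (n := n) f (p s)).2⟩ := by
  unfold lift
  congr 1
  rw [mfderiv_comp s hf hp.mdifferentiableAt]
  change mfderiv 𝓘(ℝ, ℝ) (𝓡 n) f (p s) (mfderiv 𝓘(ℝ, ℝ) 𝓘(ℝ, ℝ) p s (1 : ℝ)) = _
  refine Eq.trans ?_ (map_smul (mfderiv 𝓘(ℝ, ℝ) (𝓡 n) f (p s)) (deriv p s) (1 : ℝ))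
  congr 1
  rw [mfderiv_eq_fderiv]
  exact (mul_one (deriv p s)).symm

/-- By the inverse function theorem, `f = γ ∘ p⁻¹` near `p s`; regularity of `f` is not part of the
definition of a projective map. -/
theorem mdifferentiableAt_of_comp_eq {f γ : ℝ → M} {p : ℝ → ℝ} {J : Set ℝ} (hJ : IsOpen J)
    {s p' : ℝ} (hs : s ∈ J) (hγ : MDifferentiableAt 𝓘(ℝ, ℝ) (𝓡 n) γ s)
    (hp : HasStrictDerivAt p p' s) (hp' : p' ≠ 0) (h : ∀ t ∈ J, f (p t) = γ t) :
    MDifferentiableAt 𝓘(ℝ, ℝ) (𝓡 n) f (p s) := by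
  have hq := hp.to_localInverse hp'
  set q := hp.localInverse p p' s hp' with hqdef
  have hqs : q (p s) = s := (hp.hasStrictFDerivAt_equiv hp').localInverse_apply_image
  have hr : ∀ᶠ u in 𝓝 (p s), p (q u) = u :=
    (hp.hasStrictFDerivAt_equiv hp').eventually_right_inverse
  have hJq : ∀ᶠ u in 𝓝 (p s), q u ∈ J :=
    hq.hasDerivAt.continuousAt.eventually (by rw [hqs]; exact hJ.mem_nhds hs)
  have e : f =ᶠ[𝓝 (p s)] γ ∘ q := by
    filter_upwards [hr, hJq] with u hu hu'
    rw [Function.comp_apply, ← h _ hu', hu]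
  refine MDifferentiableAt.congr_of_eventuallyEq ?_ e
  exact MDifferentiableAt.comp (p s) (by rw [hqs]; exact hγ)
    hq.hasDerivAt.differentiableAt.mdifferentiableAt

theorem dotProduct_mulVec_eq_sum (A : Matrix (Fin n) (Fin n) ℝ) (x : Fin n → ℝ) :
    dotProduct x (A.mulVec x) = ∑ i, ∑ j, A i j * x i * x j := by
  simp only [dotProduct, Matrix.mulVec, Finset.mul_sum]
  exact Finset.sum_congr rfl fun i _ => Finset.sum_congr rfl fun j _ => by ring

/-- Homogeneity with factor 2 gives `F(x, 0) = 2 F(x, 0)`, so `F` vanishes on zero vectors. -/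
theorem IsFinsler.snd_ne_zero [IsManifold (𝓡 n) ∞ M] {F : TangentBundle (𝓡 n) M → ℝ}
    (hF : IsFinsler F) {v : TangentBundle (𝓡 n) M} (hv : F v = 1) : v.2 ≠ 0 := by
  obtain ⟨x, y⟩ := v
  intro hy
  change y = 0 at hy
  have := hF.homogeneous x y 2 two_pos
  rw [hy, smul_zero, ← hy, hv] at this
  norm_num at this

/-- A bound `Ric ≤ -c² g` bounds the Ricci curvature of unit vectors in their own direction. -/
theorem IsFinsler.sum_ricci_le [IsManifold (𝓡 n) ∞ M] {F : TangentBundle (𝓡 n) M → ℝ}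
    (hF : IsFinsler F) {c : ℝ} {v : TangentBundle (𝓡 n) M} (hv : F v = 1)
    (hRic : (-(c ^ 2) • g F v - ricci F v).PosSemidef) :
    ∑ j, ∑ k, ricci F v j k * comp v j * comp v k ≤ -c ^ 2 := by
  have h := hRic.dotProduct_mulVec_nonneg (comp v : Fin n → ℝ)
  rw [star_trivial, dotProduct_mulVec_eq_sum] at h
  simp only [Matrix.sub_apply, Matrix.smul_apply, smul_eq_mul, sub_mul, Finset.sum_sub_distrib,
    mul_assoc, ← Finset.mul_sum] at h
  have hg := hF.sum_g_mul_mul (hF.snd_ne_zero hv)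
  simp only [mul_assoc, hv] at hg ⊢
  rw [hg] at h
  linarith

theorem IsFinsler.pullbackLineElementSq_eq [IsManifold (𝓡 n) ∞ M]
    {F : TangentBundle (𝓡 n) M → ℝ} (hF : IsFinsler F) {f : ℝ → M} {u : ℝ}
    (h : (lift (n := n) f u).2 ≠ 0) (ξ : ℝ) :
    pullbackLineElementSq F f u ξ = ξ ^ 2 * F (lift f u) ^ 2 := by
  have e : comp (⟨f u, mfderiv 𝓘(ℝ, ℝ) (𝓡 n) f u ξ⟩ : TangentBundle (𝓡 n) M) =
      ξ • comp (lift (n := n) f u) := by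
    refine Eq.trans ?_ (map_smul (mfderiv 𝓘(ℝ, ℝ) (𝓡 n) f u) ξ (1 : ℝ))
    exact congrArg (fun t : ℝ => mfderiv 𝓘(ℝ, ℝ) (𝓡 n) f u t) (mul_one ξ).symm
  rw [pullbackLineElementSq, e, ← hF.sum_g_mul_mul h, Finset.mul_sum]
  refine Finset.sum_congr rfl fun i _ => ?_
  rw [Finset.mul_sum]
  refine Finset.sum_congr rfl fun j _ => ?_
  simp only [PiLp.smul_apply, smul_eq_mul]
  ring

end Manifold
end FinslerSpace

/-! ### The comparison with the Poincaré metric -/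

open FinslerSpace in
theorem theorem1 (n : ℕ) (hn : 2 ≤ n) {M : Type*} [TopologicalSpace M]
    [ChartedSpace (EuclideanSpace ℝ (Fin n)) M] [IsManifold (𝓡 n) ∞ M] [ConnectedSpace M]
    (F : TangentBundle (𝓡 n) M → ℝ) (hF : FinslerSpace.IsFinsler F)
    (c : ℝ) (hc : 0 < c)
    (hRic : ∀ v : TangentBundle (𝓡 n) M, v.2 ≠ 0 →
      (-(c ^ 2) • FinslerSpace.g F v - FinslerSpace.ricci F v).PosSemidef)
    (f : ℝ → M) (hf : FinslerSpace.IsProjectiveMap F f) :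
    ∀ u ∈ Set.Ioo (-1 : ℝ) 1, ∀ ξ : ℝ,
      FinslerSpace.pullbackLineElementSq F f u ξ ≤
        ((n : ℝ) - 1) / (4 * c ^ 2) * FinslerSpace.poincareSq u ξ := by
  obtain ⟨J, γ, p, hJ, hJc, hγ, hp, hbij, hfp⟩ := hf
  intro u hu ξ
  obtain ⟨s, hs, rfl⟩ := hbij.surjOn hu
  have hn1 : (0 : ℝ) < n - 1 := by
    have : (2 : ℝ) ≤ n := by exact_mod_cast hn
    linarith
  -- Chosen so that `2k²` is the bound `2c²/(n-1)` on minus the Schwarzian.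
  set k : ℝ := c / √((n : ℝ) - 1) with hk
  have hk0 : 0 < k := div_pos hc (Real.sqrt_pos.2 hn1)
  have hk2 : k ^ 2 = c ^ 2 / ((n : ℝ) - 1) := by rw [hk, div_pow, Real.sq_sqrt hn1.le]
  have hS : ∀ t ∈ J, schwarzian p t ≤ -2 * k ^ 2 := by
    intro t ht
    have h1 := hγ.unit_speed t ht
    have h2 := hF.sum_ricci_le h1 (hRic _ (hF.snd_ne_zero h1))
    rw [hp.schwarzian_eq t ht, hk2]
    refine (mul_le_mul_of_nonneg_left h2 (by positivity)).trans_eq ?_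
    ring
  have hmain := one_sub_sq_le_of_schwarzian_le hJ hJc hp.smooth hp.deriv_pos hbij hk0 hS hs
  have hP := hp.deriv_pos s hs
  have hpC : ContDiffAt ℝ ∞ p s := hp.smooth.contDiffAt (hJ.mem_nhds hs)
  have hfd : MDifferentiableAt 𝓘(ℝ, ℝ) (𝓡 n) f (p s) :=
    mdifferentiableAt_of_comp_eq hJ hs
      ((hγ.smooth.contMDiffAt (hJ.mem_nhds hs)).mdifferentiableAt (by simp))
      (hpC.hasStrictDerivAt (by simp)) hP.ne' hfp
  have hl : lift (n := n) γ s = ⟨f (p s), deriv p s • (lift (n := n) f (p s)).2⟩ := by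
    rw [← lift_comp hfd (hpC.differentiableAt (by simp))]
    refine lift_congr ?_
    filter_upwards [hJ.mem_nhds hs] with t ht using (hfp t ht).symm
  have hunit := hγ.unit_speed s hs
  have hne := hF.snd_ne_zero hunit
  rw [hl] at hunit hne
  have hv : (lift (n := n) f (p s)).2 ≠ 0 := right_ne_zero_of_smul hne
  -- The chain rule gives `γ' = p' f'`, and `p' > 0` comes out of `F` by homogeneity.
  have hunit' : deriv p s * F (lift f (p s)) = 1 :=
    (hF.homogeneous _ (lift (n := n) f (p s)).2 _ hP).symm.trans hunit
  rw [hF.pullbackLineElementSq_eq hv, poincareSq]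
  have hF0 : 0 ≤ F (lift f (p s)) := hF.nonneg _
  generalize F (lift f (p s)) = y at *
  have hx : 0 < 1 - p s ^ 2 := by nlinarith [hu.1, hu.2]
  have h1 : k * (1 - p s ^ 2) * y ≤ 1 :=
    (mul_le_mul_of_nonneg_right hmain hF0).trans_eq hunit'
  have h2 : k ^ 2 * (1 - p s ^ 2) ^ 2 * y ^ 2 ≤ 1 := by
    rw [← mul_pow, ← mul_pow]
    exact pow_le_one₀ (by positivity) h1
  have h3 : y ^ 2 ≤ 1 / (k ^ 2 * (1 - p s ^ 2) ^ 2) := by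
    rw [le_div_iff₀ (by positivity)]
    linarith
  refine (mul_le_mul_of_nonneg_left h3 (sq_nonneg ξ)).trans_eq ?_
  rw [hk2]
  field_simp
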